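/- Let $n_t\ge 1$ be an integer and $P>0$. In the $n_t\times 1$ MISO block Rayleigh fading channel $Y=\vec h\vec X+Z$, with $\vec h=(h_1,\dots,h_{n_t})$ having i.i.d. $\mathcal{CN}(0,1)$ entries, noise $Z\sim\mathcal{CN}(0,1)$ and total transmit power at most $P$, consider continuous-layer coding (the broadcast approach), in which each layer is sent with equal power on all $n_t$ antennas. A power distribution over the layers is a function $\rho\ge 0$ on $(0,\infty)$ with $\int_0^\infty\rho(s)\,ds\le P$. With $I(s)=\int_s^\infty\rho(u)\,du$, layer $s$ has rate (in nats) $\frac{s\rho(s)/n_t}{1+sI(s)/n_t}\,ds$ and is decoded if and only if $\sum_{\ell=1}^{n_t}|h_\ell|^2\ge s$. The continuous-layer expected-rate of $\rho$ is \[ \mathbb E\left[\int_0^{\sum_{\ell}|h_\ell|^2}\frac{s\,\rho(s)/n_t}{1+s\,I(s)/n_t}\,ds\right]. \] Then the maximum $\mathcal R_c^m$ of the continuous-layer expected-rate over all power distributions $\rho$ is attained and equals \[ \mathcal R_c^m=\mathcal R(s_1)-\mathcal R(s_0), \] where \[ \mathcal R(s)=e^{-s}\sum_{\ell=1}^{n_t-1}\frac1{\ell!}\left(s^\ell-(n_t+1-\ell)(\ell-1)!\sum_{k=0}^{\ell-1}\frac{s^k}{k!}\right)+e^{-s}-(n_t+1)\,\mathrm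 E_1(s),\qquad \mathrm E_1(x)=\int_x^\infty\frac{e^{-t}}t\,dt, \] and $s_0,s_1>0$ are the unique positive solutions of \[ \sum_{\ell=0}^{n_t-1}\frac{(n_t-1)!}{\ell!\,s_0^{\,n_t-\ell}}=1+\frac P{n_t}s_0,\qquad \sum_{\ell=0}^{n_t-1}\frac{(n_t-1)!}{\ell!\,s_1^{\,n_t-\ell}}=1 . \] -/

import Mathlib

open MeasureTheory ProbabilityTheory
open scoped Nat NNReal

noncomputable section

namespace MISO

/-- The circularly symmetric complex Gaussian law `CN(0,1)`: real and imaginary parts are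
independent real Gaussians of mean `0` and variance `1/2`. -/
def stdComplexGaussian : Measure ℂ :=
  ((gaussianReal 0 (1 / 2 : ℝ≥0)).prod (gaussianReal 0 (1 / 2 : ℝ≥0))).map
    (fun p : ℝ × ℝ => (⟨p.1, p.2⟩ : ℂ))

/-- Rayleigh fading: the channel coefficients are i.i.d. with law `CN(0,1)`. -/
structure IsRayleighFading {Ω : Type*} [MeasurableSpace Ω] (μ : Measure Ω) {n : ℕ}
    (h : Fin n → Ω → ℂ) : Prop where
  law : ∀ i, HasLaw (h i) stdComplexGaussian μ
  indep : iIndepFun h μ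

/-- The channel gain `h h†`. -/
def channelGain {Ω : Type*} {n : ℕ} (h : Fin n → Ω → ℂ) (ω : Ω) : ℝ :=
  ∑ i, ‖h i ω‖ ^ 2

/-- A distribution of the total transmit power over a continuum of layers indexed by `s > 0`:
the layers in `[s, s + ds]` have power `ρ s ds`, and the total power is at most `P`. -/
structure IsPowerDistribution (P : ℝ) (ρ : ℝ → ℝ) : Prop where
  nonneg : ∀ s, 0 < s → 0 ≤ ρ s
  integrable : IntegrableOn ρ (Set.Ioi 0)
  power_le : ∫ s in Set.Ioi 0, ρ s ≤ P

/-- The power of the layers above layer `s`, which interferes with the decoding of layer `s`. -/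
def upperPower (ρ : ℝ → ℝ) (s : ℝ) : ℝ :=
  ∫ u in Set.Ioi s, ρ u

/-- The rate (in nats) per unit layer index of layer `s`. Every layer is spread with equal power
over the `n` antennas, and layer `s` is coded so as to be decodable exactly at channel gains at
least `s`: its infinitesimal rate is
`ln (1 + (ρ s ds / n) s / (1 + (I s / n) s)) = (ρ s / n) s / (1 + (I s / n) s) ds`,
with `I s` the power of the layers above. -/
def layerRate (n : ℕ) (ρ : ℝ → ℝ) (s : ℝ) : ℝ :=
  s * (ρ s / n) / (1 + s * (upperPower ρ s / n))

/-- The rate decoded at channel gain `g`: the layers are decoded from the lowest one up to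
layer `g`. -/
def decodedRate (n : ℕ) (ρ : ℝ → ℝ) (g : ℝ) : ℝ :=
  ∫ s in Set.Ioc 0 g, layerRate n ρ s

/-- The continuous-layer expected-rate: the expectation over the fading of the decoded rate. -/
def expectedRate {Ω : Type*} [MeasurableSpace Ω] (μ : Measure Ω) {n : ℕ}
    (h : Fin n → Ω → ℂ) (ρ : ℝ → ℝ) : ℝ :=
  ∫ ω, decodedRate n ρ (channelGain h ω) ∂μ

/-- The exponential integral `E₁`. -/
def expIntegralE1 (x : ℝ) : ℝ :=
  ∫ t in Set.Ioi x, Real.exp (-t) / t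

/-- The function `𝓡` of the closed form. -/
def closedForm (n : ℕ) (s : ℝ) : ℝ :=
  Real.exp (-s) * ∑ l ∈ Finset.Icc 1 (n - 1), 1 / (l ! : ℝ) *
      (s ^ l - ((n : ℝ) + 1 - l) * ((l - 1)! : ℝ) * ∑ k ∈ Finset.range l, s ^ k / (k ! : ℝ))
    + Real.exp (-s) - ((n : ℝ) + 1) * expIntegralE1 s

/-- The sum `∑_{ℓ < n} (n-1)! / (ℓ! s^(n-ℓ))` in the equations for the limits. -/
def limitSum (n : ℕ) (s : ℝ) : ℝ :=
  ∑ l ∈ Finset.range n, ((n - 1)! : ℝ) / ((l ! : ℝ) * s ^ (n - l))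

end MISO

end

noncomputable section

namespace MISO

/-! The channel gain is Gamma distributed with shape `n` (`hasGammaTail_sum`), so by Fubini the
expected rate is `∫ T(s) r(s) ds`, with `T` the Gamma tail and `r` the layer rate
(`expectedRate_eq`). Write `f = -T'` for the density and `x(s) = I(s)/n`. Almost everywhere `r =
x/(1+sx) - (log(1+sx))'`, and integration by parts gives `T r = [T x/(1+sx) - f log(1+sx)] - (T
log(1+sx))'`. The bracket contains no derivative of `x`, so it can be maximized separately at each
`s` over `0 ≤ x ≤ P/n`.

Its `x`-derivative has the sign of `L(s) - (1+sx)`, where `L = T/(s f)` is `limitSum`. Since `L` is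
decreasing, the clipped maximizer is `P/n` up to `s₀`, `(L-1)/s` on `[s₀, s₁]`, and `0` beyond; the
two equations mark where clipping starts and ends. This profile is the residual power of an
admissible distribution, so the pointwise bound is attained (`powerIntegrand_le_optimalPower`,
`integral_layerRate_le`).

On the support of the optimum, `T r = T (n+1-s)/s`, which has antiderivative `closedForm`
(`hasDerivAt_closedForm`, `integral_layerRate_optimalPower`). -/

/-- The tail `P(G ≥ s)`, `s ≥ 0`, of the Gamma distribution with shape `n` and rate `1`. -/
def gammaTail (n : ℕ) (s : ℝ) : ℝ :=
  Real.exp (-s) * ∑ k ∈ Finset.range n, s ^ k / (k ! : ℝ)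

/-- The density of the Gamma distribution with shape `n` and rate `1`. -/
def gammaDensity (n : ℕ) (s : ℝ) : ℝ :=
  Real.exp (-s) * (s ^ (n - 1) / ((n - 1)! : ℝ))

/-! ### Bounds and derivatives for the Gamma tail and density -/

lemma gammaTail_succ (n : ℕ) (s : ℝ) :
    gammaTail (n + 1) s = gammaTail n s + Real.exp (-s) * (s ^ n / (n ! : ℝ)) := by
  rw [gammaTail, Finset.sum_range_succ, mul_add, gammaTail]

lemma gammaTail_nonneg (n : ℕ) {s : ℝ} (hs : 0 ≤ s) : 0 ≤ gammaTail n s := by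
  unfold gammaTail; positivity

lemma gammaTail_le_one (n : ℕ) {s : ℝ} (hs : 0 ≤ s) : gammaTail n s ≤ 1 := by
  rw [gammaTail, Real.exp_neg, inv_mul_le_one₀ (Real.exp_pos s)]
  exact Real.sum_le_exp_of_nonneg hs n

/-- Termwise, `s · s^k/k! = (k+1) s^(k+1)/(k+1)!` with `k + 1 ≤ n`. The resulting bound `s T(s) ≤ n`
is what makes `ρ` dominate the tail-weighted layer rate. -/
lemma mul_gammaTail_le (n : ℕ) {s : ℝ} (hs : 0 ≤ s) :
    s * gammaTail n s ≤ n * gammaTail (n + 1) s := by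
  have h : ∑ k ∈ Finset.range n, s * (s ^ k / (k ! : ℝ)) ≤
      n * ∑ k ∈ Finset.range n, s ^ (k + 1) / ((k + 1)! : ℝ) := by
    rw [Finset.mul_sum]
    refine Finset.sum_le_sum fun k hk => ?_
    have hk' : (k : ℝ) + 1 ≤ n := by exact_mod_cast Finset.mem_range.1 hk
    have e : s * (s ^ k / (k ! : ℝ)) = (k + 1) * (s ^ (k + 1) / ((k + 1)! : ℝ)) := by
      rw [Nat.factorial_succ, pow_succ]; push_cast; field_simp
    rw [e]
    gcongr
  calc s * gammaTail n s = Real.exp (-s) * ∑ k ∈ Finset.range n, s * (s ^ k / (k ! : ℝ)) := by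
        rw [gammaTail, ← Finset.mul_sum]; ring
    _ ≤ Real.exp (-s) * (n * ∑ k ∈ Finset.range (n + 1), s ^ k / (k ! : ℝ)) := by
        rw [Finset.sum_range_succ']
        gcongr
        refine h.trans ?_
        gcongr
        simp
    _ = n * gammaTail (n + 1) s := by rw [gammaTail]; ring

lemma hasDerivAt_gammaTail_succ (n : ℕ) (s : ℝ) :
    HasDerivAt (gammaTail (n + 1)) (-gammaDensity (n + 1) s) s := by
  induction n with
  | zero =>
    have : gammaTail (0 + 1) = fun s => Real.exp (-s) := by ext x; simp [gammaTail]
    rw [this]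
    simpa [gammaDensity] using (hasDerivAt_neg s).exp
  | succ n ih =>
    have e : gammaTail (n + 1 + 1) = fun s =>
        gammaTail (n + 1) s + Real.exp (-s) * (s ^ (n + 1) / ((n + 1)! : ℝ)) := by
      ext x; exact gammaTail_succ _ _
    rw [e]
    have h2 := (hasDerivAt_neg s).exp.mul ((hasDerivAt_pow (n + 1) s).div_const ((n + 1)! : ℝ))
    refine (ih.add h2).congr_deriv ?_
    simp only [gammaDensity, add_tsub_cancel_right]
    rw [Nat.factorial_succ n]; push_cast
    field_simp
    ring

lemma hasDerivAt_gammaTail {n : ℕ} (hn : 1 ≤ n) (s : ℝ) :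
    HasDerivAt (gammaTail n) (-gammaDensity n s) s := by
  obtain ⟨m, rfl⟩ := Nat.exists_eq_add_of_le' hn
  exact hasDerivAt_gammaTail_succ m s

lemma continuous_gammaTail (n : ℕ) : Continuous (gammaTail n) := by
  unfold gammaTail; fun_prop

lemma continuous_gammaDensity (n : ℕ) : Continuous (gammaDensity n) := by
  unfold gammaDensity; fun_prop

lemma gammaDensity_pos (n : ℕ) {s : ℝ} (hs : 0 < s) : 0 < gammaDensity n s := by
  unfold gammaDensity; positivity

lemma hasDerivAt_gammaDensity {n : ℕ} (hn : 1 ≤ n) {s : ℝ} (hs : 0 < s) :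
    HasDerivAt (gammaDensity n) (gammaDensity n s * ((n - 1) / s - 1)) s := by
  obtain ⟨m, rfl⟩ := Nat.exists_eq_add_of_le' hn
  have h := (hasDerivAt_neg s).exp.mul ((hasDerivAt_pow m s).div_const (m ! : ℝ))
  have e : gammaDensity (m + 1) = fun s => Real.exp (-s) * (s ^ m / (m ! : ℝ)) := by
    ext x; simp [gammaDensity]
  rw [e]
  refine h.congr_deriv ?_
  rcases m with _ | m
  · simp
  · simp only [add_tsub_cancel_right]
    push_cast
    field_simp
    ring

/-! ### The function `limitSum` -/

/-- Explains the sum in the limit equations: it is the value that `1 + s x` takes at the stationary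
point of the integrand. -/
lemma limitSum_eq (n : ℕ) {s : ℝ} (hs : 0 < s) :
    limitSum n s = gammaTail n s / (s * gammaDensity n s) := by
  rcases n with _ | n
  · simp [limitSum, gammaTail]
  have hd := gammaDensity_pos (n + 1) hs
  rw [eq_div_iff (by positivity), limitSum, gammaTail, Finset.sum_mul, Finset.mul_sum]
  refine Finset.sum_congr rfl fun l hl => ?_
  have hl' : l < n + 1 := Finset.mem_range.1 hl
  have e : s * s ^ n = s ^ (n + 1 - l) * s ^ l := by
    rw [← pow_succ', ← pow_add]; congr 1; omega
  simp only [gammaDensity, add_tsub_cancel_right]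
  field_simp
  linear_combination e

/-- Each of the `n` terms is at most `1/s`, because `(n-1)!/l! ≤ n^(n-1-l) ≤ s^(n-1-l)`. -/
lemma limitSum_le (n : ℕ) {s : ℝ} (hs : (n : ℝ) ≤ s) (hs0 : 0 < s) : limitSum n s ≤ n / s := by
  have : ∀ l ∈ Finset.range n, ((n - 1)! : ℝ) / ((l ! : ℝ) * s ^ (n - l)) ≤ 1 / s := by
    intro l hl
    have hl' : l < n := Finset.mem_range.1 hl
    rw [div_le_div_iff₀ (by positivity) hs0]
    have h1 : (n - 1)! ≤ l ! * n ^ (n - 1 - l) := by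
      have h2 : l ! * (l + 1).ascFactorial (n - 1 - l) = (l + (n - 1 - l))! :=
        Nat.factorial_mul_ascFactorial l (n - 1 - l)
      rw [show n - 1 = l + (n - 1 - l) by omega, ← h2]
      gcongr
      have h3 := Nat.ascFactorial_le_pow_add l (n - 1 - l)
      refine h3.trans ?_
      rw [show l + (n - 1 - l) - l = n - 1 - l by omega]
      exact Nat.pow_le_pow_left (by omega) _
    have h1' : ((n - 1)! : ℝ) ≤ (l ! : ℝ) * (n : ℝ) ^ (n - 1 - l) := by exact_mod_cast h1
    calc ((n - 1)! : ℝ) * s ≤ (l ! : ℝ) * (n : ℝ) ^ (n - 1 - l) * s := by gcongr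
      _ ≤ (l ! : ℝ) * s ^ (n - 1 - l) * s := by gcongr
      _ = 1 * ((l ! : ℝ) * s ^ (n - l)) := by
        rw [show n - l = n - 1 - l + 1 by omega, pow_succ]; ring
  calc limitSum n s ≤ ∑ l ∈ Finset.range n, 1 / s := Finset.sum_le_sum this
    _ = n / s := by simp [div_eq_mul_inv]

lemma one_div_le_limitSum {n : ℕ} (hn : 1 ≤ n) {s : ℝ} (hs : 0 < s) : 1 / s ≤ limitSum n s := by
  obtain ⟨m, rfl⟩ := Nat.exists_eq_add_of_le' hn
  rw [limitSum, Finset.sum_range_succ]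
  have h : 0 ≤ ∑ l ∈ Finset.range m, ((m + 1 - 1)! : ℝ) / ((l ! : ℝ) * s ^ (m + 1 - l)) :=
    Finset.sum_nonneg fun l _ => by positivity
  have e : ((m + 1 - 1)! : ℝ) / ((m ! : ℝ) * s ^ (m + 1 - m)) = 1 / s := by
    simp only [add_tsub_cancel_right, add_tsub_cancel_left, pow_one]
    field_simp
  linarith

lemma limitSum_strictAntiOn {n : ℕ} (hn : 1 ≤ n) : StrictAntiOn (limitSum n) (Set.Ioi 0) := by
  intro a ha b hb hab
  have ha : 0 < a := ha
  refine Finset.sum_lt_sum_of_nonempty (Finset.nonempty_range_iff.2 (by omega)) fun l hl => ?_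
  have hl' : l < n := Finset.mem_range.1 hl
  have : a ^ (n - l) < b ^ (n - l) := pow_lt_pow_left₀ hab ha.le (by omega)
  gcongr

lemma continuousOn_limitSum (n : ℕ) : ContinuousOn (limitSum n) (Set.Ioi 0) := by
  unfold limitSum
  refine continuousOn_finsetSum _ fun l _ => continuousOn_const.div (by fun_prop) ?_
  intro x hx
  have hx : 0 < x := hx
  positivity

lemma existsUnique_limitSum {n : ℕ} (hn : 1 ≤ n) {c : ℝ} (hc : 0 ≤ c) :
    ∃! s : ℝ, 0 < s ∧ limitSum n s = 1 + c * s := by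
  have hn0 : (0 : ℝ) < n := by exact_mod_cast hn
  -- Left end for the intermediate value theorem: `limitSum n a ≥ 1/a = 1 + c ≥ 1 + c a`, as `a ≤
  -- 1`. At the right end `n + 1` the sum is at most `n/(n+1) ≤ 1`.
  set a : ℝ := 1 / (1 + c) with ha
  have ha0 : 0 < a := by positivity
  have ha1 : a ≤ 1 := by rw [ha, div_le_one (by positivity)]; linarith
  have hab : a ≤ (n : ℝ) + 1 := by linarith
  have hcont : ContinuousOn (fun s => limitSum n s - (1 + c * s)) (Set.Icc a (n + 1)) :=
    ((continuousOn_limitSum n).mono fun x hx => ha0.trans_le hx.1).sub (by fun_prop)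
  have hA : 0 ≤ limitSum n a - (1 + c * a) := by
    have h1 := one_div_le_limitSum hn ha0
    have h2 : 1 / a = 1 + c := by rw [ha, one_div_one_div]
    nlinarith
  have hB : limitSum n (n + 1) - (1 + c * (n + 1)) ≤ 0 := by
    have h1 := limitSum_le n (s := n + 1) (by linarith) (by positivity)
    have h2 : (n : ℝ) / (n + 1) ≤ 1 := by rw [div_le_one (by positivity)]; linarith
    have : 0 ≤ c * (n + 1) := by positivity
    linarith
  obtain ⟨s, hs, hs'⟩ := intermediate_value_Icc' hab hcont ⟨hB, hA⟩
  have hs0 : 0 < s := ha0.trans_le hs.1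
  refine ⟨s, ⟨hs0, by simpa [sub_eq_zero] using hs'⟩, ?_⟩
  have key : ∀ x y : ℝ, 0 < x → limitSum n x = 1 + c * x → limitSum n y = 1 + c * y →
      ¬ x < y := by
    intro x y hx h1 h2 hxy
    have := limitSum_strictAntiOn hn hx (hx.trans hxy : (0 : ℝ) < y) hxy
    nlinarith
  have hs2 : limitSum n s = 1 + c * s := by simpa [sub_eq_zero] using hs'
  rintro t ⟨ht0, ht⟩
  exact le_antisymm (not_lt.1 (key s t hs0 hs2 ht)) (not_lt.1 (key t s ht0 ht hs2))

/-- Quotient rule on `T/(s f)`, written as a differential equation in `limitSum` itself so that the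
optimal density comes out in closed form. -/
lemma hasDerivAt_limitSum {n : ℕ} (hn : 1 ≤ n) {s : ℝ} (hs : 0 < s) :
    HasDerivAt (limitSum n) (-(1 + limitSum n s * (n - s)) / s) s := by
  have hd := gammaDensity_pos n hs
  have h := (hasDerivAt_gammaTail hn s).div ((hasDerivAt_id s).mul (hasDerivAt_gammaDensity hn hs))
    (by simp only [id, Pi.mul_apply]; positivity)
  refine (h.congr_of_eventuallyEq ?_).congr_deriv ?_
  · filter_upwards [lt_mem_nhds hs] with x hx
    simpa using limitSum_eq n hx
  · rw [limitSum_eq n hs]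
    simp only [id, Pi.mul_apply]
    field_simp
    ring

/-! ### The closed form as an antiderivative -/

lemma hasDerivAt_expIntegralE1 {s : ℝ} (hs : 0 < s) :
    HasDerivAt expIntegralE1 (-(Real.exp (-s) / s)) s := by
  have hc : ContinuousOn (fun t : ℝ => Real.exp (-t) / t) (Set.Ioi 0) :=
    (by fun_prop : Continuous fun t : ℝ => Real.exp (-t)).continuousOn.div continuousOn_id
      fun x hx => ne_of_gt hx
  have hint : ∀ a : ℝ, 0 < a → IntegrableOn (fun t : ℝ => Real.exp (-t) / t) (Set.Ioi a) := by
    intro a ha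
    refine Integrable.mono' ((integrableOn_exp_neg_Ioi a).div_const a) ?_ ?_
    · exact (hc.mono fun x hx => ha.trans hx).aestronglyMeasurable measurableSet_Ioi
    · refine (ae_restrict_iff' measurableSet_Ioi).2 (Filter.Eventually.of_forall fun x hx => ?_)
      have hx : a < x := hx
      have hx0 := ha.trans hx
      rw [Real.norm_of_nonneg (by positivity)]
      gcongr
  have ha : 0 < s / 2 := by positivity
  -- Anchoring at `s/2` turns the moving lower limit of the improper integral into the endpoint of
  -- an interval integral near `s`.
  have e : ∀ x ∈ Set.Ioi (s / 2), expIntegralE1 x =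
      expIntegralE1 (s / 2) - ∫ t in (s / 2)..x, Real.exp (-t) / t := by
    intro x hx
    rw [expIntegralE1, expIntegralE1, ← intervalIntegral.integral_Ioi_sub_Ioi (hint _ ha) hx.le]
    ring
  have hs2 : s / 2 < s := by linarith
  have hd := intervalIntegral.integral_hasDerivAt_right (a := s / 2) (b := s)
    (f := fun t : ℝ => Real.exp (-t) / t)
    ((hc.mono fun x hx => by
      rw [Set.uIcc_of_le hs2.le] at hx; exact ha.trans_le hx.1).intervalIntegrable)
    (hc.stronglyMeasurableAtFilter isOpen_Ioi s hs) (hc.continuousAt (Ioi_mem_nhds hs))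
  refine ((hasDerivAt_const s (expIntegralE1 (s / 2))).sub hd).congr_of_eventuallyEq ?_ |>.congr_deriv
    (by ring)
  filter_upwards [Ioi_mem_nhds hs2] with x hx
  exact e x hx

lemma sum_Icc_one_eq (f : ℕ → ℝ) (m : ℕ) :
    ∑ l ∈ Finset.Icc 1 m, f l = ∑ j ∈ Finset.range m, f (j + 1) := by
  induction m with
  | zero => simp
  | succ m ih => rw [Finset.sum_Icc_succ_top (by omega), ih, Finset.sum_range_succ]

lemma closedForm_succ (m : ℕ) (s : ℝ) :
    closedForm (m + 1) s = ∑ j ∈ Finset.range m, (Real.exp (-s) * (s ^ (j + 1) / ((j + 1)! : ℝ)) -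
      ((m : ℝ) + 1 - j) / (j + 1) * gammaTail (j + 1) s) + Real.exp (-s)
      - ((m : ℝ) + 2) * expIntegralE1 s := by
  rw [closedForm, add_tsub_cancel_right, sum_Icc_one_eq, Finset.mul_sum]
  congr 1
  · refine congrArg (· + Real.exp (-s)) (Finset.sum_congr rfl fun j _ => ?_)
    rw [gammaTail, add_tsub_cancel_right, Nat.factorial_succ]
    push_cast
    field_simp
    ring
  · push_cast; ring

/-- The weights in the closed form are tuned so that summand `j` contributes exactly the term `k = j
+ 1` of the tail times `(n+1)/s - 1`: indeed `1 + (m+1-j)/(j+1) = (m+2)/(j+1)`. The term `k = 0`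
comes from `exp (-s)` and the exponential integral. -/
lemma hasDerivAt_closedForm {n : ℕ} (hn : 1 ≤ n) {s : ℝ} (hs : 0 < s) :
    HasDerivAt (closedForm n) (gammaTail n s * (n + 1 - s) / s) s := by
  obtain ⟨m, rfl⟩ := Nat.exists_eq_add_of_le' hn
  have h1 : ∀ j ∈ Finset.range m, HasDerivAt (fun s => Real.exp (-s) * (s ^ (j + 1) / ((j + 1)! : ℝ)) -
      ((m : ℝ) + 1 - j) / (j + 1) * gammaTail (j + 1) s)
      (Real.exp (-s) * ((m + 2) / s - 1) * (s ^ (j + 1) / ((j + 1)! : ℝ))) s := by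
    intro j _
    have h := ((hasDerivAt_neg s).exp.mul
      ((hasDerivAt_pow (j + 1) s).div_const ((j + 1)! : ℝ))).sub
      ((hasDerivAt_gammaTail_succ j s).const_mul (((m : ℝ) + 1 - j) / (j + 1)))
    refine h.congr_deriv ?_
    simp only [gammaDensity, add_tsub_cancel_right]
    rw [Nat.factorial_succ j]; push_cast
    field_simp
    ring
  have h := ((HasDerivAt.fun_sum h1).add (hasDerivAt_neg s).exp).sub
    ((hasDerivAt_expIntegralE1 hs).const_mul ((m : ℝ) + 2))
  have e : closedForm (m + 1) = _ := funext (closedForm_succ m)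
  rw [e]
  refine h.congr_deriv ?_
  rw [gammaTail, Finset.sum_range_succ', ← Finset.mul_sum]
  push_cast
  simp only [pow_zero, Nat.factorial_zero, Nat.cast_one]
  field_simp
  ring

/-! ### The law of the channel gain -/

/-- The exponential law of rate `1`. -/
def expLaw : Measure ℝ :=
  (volume.restrict (Set.Ioi 0)).withDensity fun x => ENNReal.ofReal (Real.exp (-x))

lemma lintegral_expLaw {g : ℝ → ENNReal} (hg : Measurable g) :
    ∫⁻ x, g x ∂expLaw = ∫⁻ x in Set.Ioi (0 : ℝ), ENNReal.ofReal (Real.exp (-x)) * g x := by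
  rw [expLaw, lintegral_withDensity_eq_lintegral_mul _ (by fun_prop) hg]
  rfl

instance : SFinite expLaw := by unfold expLaw; infer_instance

lemma gaussianPDF_half_mul (x y : ℝ) :
    gaussianPDF 0 (1 / 2 : ℝ≥0) x * gaussianPDF 0 (1 / 2 : ℝ≥0) y =
      ENNReal.ofReal (Real.exp (-(x ^ 2 + y ^ 2)) / Real.pi) := by
  rw [gaussianPDF, gaussianPDF, ← ENNReal.ofReal_mul (gaussianPDFReal_nonneg _ _ _)]
  congr 1
  simp only [gaussianPDFReal]
  have e : 2 * Real.pi * ((1 / 2 : ℝ≥0) : ℝ) = Real.pi := by push_cast; ring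
  have e2 : 2 * ((1 / 2 : ℝ≥0) : ℝ) = 1 := by push_cast; ring
  rw [e, e2]
  have e3 : -(x ^ 2 + y ^ 2) = -(x - 0) ^ 2 / 1 + -(y - 0) ^ 2 / 1 := by ring
  rw [e3, Real.exp_add]
  have hpi := Real.mul_self_sqrt Real.pi_pos.le
  have hp : 0 < Real.sqrt Real.pi := Real.sqrt_pos.2 Real.pi_pos
  field_simp
  rw [sq, hpi]

/-- In polar coordinates the planar density `exp(-r²)/π` integrates over the angle to `2 r
exp(-r²)`, and substituting `x = r²` leaves the exponential density. -/
lemma lintegral_normSq_stdComplexGaussian {g : ℝ → ENNReal} (hg : Measurable g) :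
    ∫⁻ z, g (‖z‖ ^ 2) ∂stdComplexGaussian = ∫⁻ x, g x ∂expLaw := by
  have hm : Measurable (fun p : ℝ × ℝ => (⟨p.1, p.2⟩ : ℂ)) :=
    Complex.measurableEquivRealProd.symm.measurable
  have hv : (1 / 2 : ℝ≥0) ≠ 0 := by norm_num
  have hnorm : ∀ p : ℝ × ℝ, ‖(⟨p.1, p.2⟩ : ℂ)‖ ^ 2 = p.1 ^ 2 + p.2 ^ 2 := by
    intro p
    rw [← Complex.normSq_eq_norm_sq, Complex.normSq_mk]; ring
  rw [stdComplexGaussian, lintegral_map (by fun_prop) hm,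
    gaussianReal_of_var_ne_zero _ hv, prod_withDensity (measurable_gaussianPDF _ _)
      (measurable_gaussianPDF _ _), lintegral_withDensity_eq_lintegral_mul]
  rotate_left
  · exact ((measurable_gaussianPDF _ _).comp measurable_fst).mul
      ((measurable_gaussianPDF _ _).comp measurable_snd)
  · fun_prop
  simp only [Pi.mul_apply, hnorm, gaussianPDF_half_mul]
  rw [← Measure.volume_eq_prod, ← lintegral_comp_polarCoord_symm, lintegral_expLaw hg]
  have himg : (fun r : ℝ => r ^ 2) '' Set.Ioi 0 = Set.Ioi 0 := by
    ext x
    constructor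
    · rintro ⟨r, hr, rfl⟩
      have hr : 0 < r := hr
      exact pow_pos hr 2
    · intro hx
      exact ⟨Real.sqrt x, Real.sqrt_pos.2 hx, Real.sq_sqrt (le_of_lt hx)⟩
  have hcv := lintegral_image_eq_lintegral_abs_deriv_mul (s := Set.Ioi (0 : ℝ))
    (f := fun r : ℝ => r ^ 2) (f' := fun r => 2 * r) measurableSet_Ioi
    (fun x _ => by simpa using (hasDerivAt_pow 2 x).hasDerivWithinAt)
    (fun a ha b hb hab => (pow_left_inj₀ (le_of_lt ha) (le_of_lt hb) two_ne_zero).1 hab)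
    (fun x => ENNReal.ofReal (Real.exp (-x)) * g x)
  rw [himg] at hcv
  rw [hcv]
  have ht : polarCoord.target = Set.Ioi (0 : ℝ) ×ˢ Set.Ioo (-Real.pi) Real.pi := rfl
  rw [ht, Measure.volume_eq_prod, ← Measure.prod_restrict, lintegral_prod]
  · refine setLIntegral_congr_fun measurableSet_Ioi fun r hr => ?_
    have hr : 0 < r := hr
    have hsq : ∀ θ : ℝ, (polarCoord.symm (r, θ)).1 ^ 2 + (polarCoord.symm (r, θ)).2 ^ 2 = r ^ 2 := by
      intro θ
      simp only [polarCoord_symm_apply]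
      linear_combination r ^ 2 * Real.cos_sq_add_sin_sq θ
    simp only [hsq, smul_eq_mul, lintegral_const, Measure.restrict_apply MeasurableSet.univ,
      Set.univ_inter, Real.volume_Ioo]
    rw [abs_of_pos (by positivity), ← mul_assoc, ← mul_assoc, mul_right_comm,
      ← ENNReal.ofReal_mul hr.le, ← ENNReal.ofReal_mul (by positivity),
      ← ENNReal.ofReal_mul (by positivity)]
    congr 2
    have := Real.pi_pos
    field_simp
    ring
  · refine Measurable.aemeasurable ?_
    simp only [polarCoord_symm_apply]
    fun_prop

lemma map_normSq_stdComplexGaussian :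
    stdComplexGaussian.map (fun z => ‖z‖ ^ 2) = expLaw := by
  ext s hs
  rw [← lintegral_indicator_one hs, ← lintegral_indicator_one hs,
    lintegral_map (measurable_one.indicator hs) (by fun_prop)]
  exact lintegral_normSq_stdComplexGaussian (measurable_one.indicator hs)

/-- The exponentials combine to the constant `exp (-s)`, leaving a polynomial in `s - y` with an
explicit primitive. -/
lemma integral_gammaTail_sub_mul_exp (n : ℕ) (s : ℝ) :
    ∫ y in (0 : ℝ)..s, Real.exp (-y) * gammaTail n (s - y) =
      Real.exp (-s) * ∑ k ∈ Finset.range n, s ^ (k + 1) / ((k + 1)! : ℝ) := by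
  have hd : ∀ y ∈ Set.uIcc 0 s, HasDerivAt
      (fun y => -(Real.exp (-s) * ∑ k ∈ Finset.range n, (s - y) ^ (k + 1) / ((k + 1)! : ℝ)))
      (Real.exp (-y) * gammaTail n (s - y)) y := by
    intro y _
    have h1 : ∀ k ∈ Finset.range n, HasDerivAt (fun y => (s - y) ^ (k + 1) / ((k + 1)! : ℝ))
        (-((s - y) ^ k / (k ! : ℝ))) y := by
      intro k _
      refine ((((hasDerivAt_id y).const_sub s).pow (k + 1)).div_const _).congr_deriv ?_
      simp only [id, add_tsub_cancel_right]
      rw [Nat.factorial_succ]; push_cast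
      field_simp
    refine ((HasDerivAt.fun_sum h1).const_mul (Real.exp (-s))).neg.congr_deriv ?_
    rw [gammaTail, ← mul_assoc, ← Real.exp_add, Finset.sum_neg_distrib]
    ring_nf
  rw [intervalIntegral.integral_eq_sub_of_hasDerivAt hd]
  · simp
  · refine Continuous.intervalIntegrable ?_ _ _
    have := continuous_gammaTail n
    fun_prop

/-- `α` is a law on `[0, ∞)` with the tail of the Gamma distribution of shape `n` and rate `1`. -/
def HasGammaTail (n : ℕ) (α : Measure ℝ) : Prop :=
  ∀ s : ℝ, α (Set.Ici s) = if 0 < s then ENNReal.ofReal (gammaTail n s) else 1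

/-- Condition on the exponential summand `y`: for `y < s` the other summand must exceed `s - y`, and
for `y ≥ s` the event is certain. The second part supplies the missing term `k = 0` of the new tail.
-/
lemma HasGammaTail.conv {n : ℕ} {α : Measure ℝ} [SFinite α] (hα : HasGammaTail n α)
    (hp : expLaw Set.univ = 1) :
    HasGammaTail (n + 1) ((α.prod expLaw).map fun p => p.1 + p.2) := by
  intro s
  rw [Measure.map_apply (by fun_prop) measurableSet_Ici,
    Measure.prod_apply_symm (measurableSet_Ici.preimage (by fun_prop))]
  have e : ∀ y : ℝ, (fun x => (x, y)) ⁻¹' ((fun p : ℝ × ℝ => p.1 + p.2) ⁻¹' Set.Ici s) =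
      Set.Ici (s - y) := by
    intro y; ext x; simp
  simp only [e, hα _]
  have hgm : Measurable (gammaTail n) := (continuous_gammaTail n).measurable
  have hmeas : Measurable fun y : ℝ =>
      if 0 < s - y then ENNReal.ofReal (gammaTail n (s - y)) else 1 := by
    refine Measurable.ite (measurableSet_lt measurable_const (by fun_prop)) ?_ measurable_const
    exact (hgm.comp (by fun_prop)).ennreal_ofReal
  rw [lintegral_expLaw hmeas]
  split_ifs with hs
  · rw [← Set.Ioo_union_Ici_eq_Ioi hs, lintegral_union measurableSet_Ici
      (Set.disjoint_left.2 fun x hx hx' => not_lt.2 hx' hx.2)]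
    have h1 : ∫⁻ y in Set.Ioo 0 s, ENNReal.ofReal (Real.exp (-y)) *
        (if 0 < s - y then ENNReal.ofReal (gammaTail n (s - y)) else 1) =
        ENNReal.ofReal (∫ y in (0 : ℝ)..s, Real.exp (-y) * gammaTail n (s - y)) := by
      rw [intervalIntegral.integral_of_le hs.le, integral_Ioc_eq_integral_Ioo,
        ofReal_integral_eq_lintegral_ofReal]
      · refine setLIntegral_congr_fun measurableSet_Ioo fun y hy => ?_
        have : 0 < s - y := sub_pos.2 hy.2
        simp only [if_pos this]
        rw [ENNReal.ofReal_mul (Real.exp_pos _).le]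
      · have hc : Continuous fun y => Real.exp (-y) * gammaTail n (s - y) := by
          have := continuous_gammaTail n
          fun_prop
        exact hc.integrableOn_Icc.mono_set Set.Ioo_subset_Icc_self
      · refine (ae_restrict_iff' measurableSet_Ioo).2 (Filter.Eventually.of_forall fun y hy => ?_)
        have : 0 ≤ s - y := sub_nonneg.2 hy.2.le
        exact mul_nonneg (Real.exp_pos _).le (gammaTail_nonneg n this)
    have h2 : ∫⁻ y in Set.Ici s, ENNReal.ofReal (Real.exp (-y)) *
        (if 0 < s - y then ENNReal.ofReal (gammaTail n (s - y)) else 1) =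
        ENNReal.ofReal (Real.exp (-s)) := by
      rw [← integral_exp_neg_Ioi s, ← integral_Ici_eq_integral_Ioi,
        ofReal_integral_eq_lintegral_ofReal]
      · refine setLIntegral_congr_fun measurableSet_Ici fun y hy => ?_
        have : ¬ 0 < s - y := not_lt.2 (sub_nonpos.2 hy)
        simp only [if_neg this, mul_one]
      · exact (integrableOn_Ici_iff_integrableOn_Ioi (by simp)).2 (integrableOn_exp_neg_Ioi s)
      · exact Filter.Eventually.of_forall fun y => (Real.exp_pos _).le
    rw [h1, h2, integral_gammaTail_sub_mul_exp, ← ENNReal.ofReal_add (by positivity) (by positivity),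
      gammaTail, Finset.sum_range_succ']
    congr 1
    simp
    ring
  · refine Eq.trans ?_ hp
    rw [expLaw, withDensity_apply _ MeasurableSet.univ, Measure.restrict_univ]
    refine setLIntegral_congr_fun measurableSet_Ioi fun y hy => ?_
    have hy : 0 < y := hy
    have : ¬ 0 < s - y := by linarith
    simp only [if_neg this, mul_one]

lemma hasGammaTail_sum {Ω : Type*} [MeasurableSpace Ω] {μ : Measure Ω} [IsProbabilityMeasure μ]
    {n : ℕ} {h : Fin n → Ω → ℂ} (hh : IsRayleighFading μ h) (S : Finset (Fin n)) :
    HasGammaTail S.card (μ.map (∑ i ∈ S, fun ω => ‖h i ω‖ ^ 2)) := by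
  have hm : ∀ i, AEMeasurable (fun ω => ‖h i ω‖ ^ 2) μ := fun i =>
    ((hh.law i).aemeasurable.norm).pow_const 2
  have hlaw : ∀ i, μ.map (fun ω => ‖h i ω‖ ^ 2) = expLaw := by
    intro i
    rw [← map_normSq_stdComplexGaussian, ← (hh.law i).map_eq,
      AEMeasurable.map_map_of_aemeasurable (by fun_prop) (hh.law i).aemeasurable]
    rfl
  have hind : iIndepFun (fun i ω => ‖h i ω‖ ^ 2) μ :=
    hh.indep.comp (fun _ z => ‖z‖ ^ 2) fun _ => by fun_prop
  induction S using Finset.induction_on with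
  -- Shape `0` is the Dirac mass at `0`, whose tail at `s > 0` is the empty sum.
  | empty =>
    intro s
    simp only [Finset.sum_empty, Finset.card_empty]
    rw [show (0 : Ω → ℝ) = fun _ => 0 from rfl, Measure.map_const]
    simp only [measure_univ, one_smul, Measure.dirac_apply' _ measurableSet_Ici]
    by_cases hs : 0 < s
    · simp [hs, gammaTail]
    · simp [hs, not_lt.1 hs]
  | insert i S hi ih =>
    rw [Finset.card_insert_of_notMem hi, Finset.sum_insert hi]
    have hmS : AEMeasurable (∑ j ∈ S, fun ω => ‖h j ω‖ ^ 2) μ :=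
      Finset.aemeasurable_sum _ fun j _ => hm j
    have hI := hind.indepFun_finsetSum_of_notMem₀ hm hi
    have hpm := (indepFun_iff_map_prod_eq_prod_map_map hmS (hm i)).1 hI
    rw [hlaw i] at hpm
    -- The total mass needs no integral: this measure is the image of a probability measure.
    have hp : expLaw Set.univ = 1 := by
      have := Measure.isProbabilityMeasure_map (hm i)
      rw [← hlaw i]; exact measure_univ
    have := ih.conv hp
    rw [← hpm, AEMeasurable.map_map_of_aemeasurable (by fun_prop) (hmS.prodMk (hm i))] at this
    convert this using 2
    ext ω
    simp [add_comm]

lemma aemeasurable_channelGain {Ω : Type*} [MeasurableSpace Ω] {μ : Measure Ω}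
    {n : ℕ} {h : Fin n → Ω → ℂ} (hh : IsRayleighFading μ h) :
    AEMeasurable (channelGain h) μ := by
  unfold channelGain
  exact Finset.aemeasurable_fun_sum _ fun i _ => ((hh.law i).aemeasurable.norm).pow_const 2

lemma measure_le_channelGain {Ω : Type*} [MeasurableSpace Ω] {μ : Measure Ω}
    [IsProbabilityMeasure μ] {n : ℕ} {h : Fin n → Ω → ℂ} (hh : IsRayleighFading μ h) {s : ℝ}
    (hs : 0 < s) : μ {ω | s ≤ channelGain h ω} = ENNReal.ofReal (gammaTail n s) := by
  have := hasGammaTail_sum hh Finset.univ s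
  have e : (∑ i, fun ω => ‖h i ω‖ ^ 2) = channelGain h := by
    ext ω; simp [channelGain]
  rw [e, if_pos hs, Finset.card_univ, Fintype.card_fin,
    Measure.map_apply_of_aemeasurable (aemeasurable_channelGain hh) measurableSet_Ici] at this
  exact this

/-! ### Power distributions and the expected rate as an integral over the layers -/

namespace IsPowerDistribution

variable {P : ℝ} {ρ : ℝ → ℝ}

lemma intervalIntegrable (hρ : IsPowerDistribution P ρ) {b : ℝ} (hb : 0 ≤ b) :
    IntervalIntegrable ρ volume 0 b :=
  (intervalIntegrable_iff_integrableOn_Ioc_of_le hb).2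
    (hρ.integrable.mono_set Set.Ioc_subset_Ioi_self)

lemma upperPower_eq (hρ : IsPowerDistribution P ρ) {s : ℝ} (hs : 0 ≤ s) :
    upperPower ρ s = upperPower ρ 0 - ∫ u in (0 : ℝ)..s, ρ u := by
  rw [upperPower, upperPower, ← intervalIntegral.integral_Ioi_sub_Ioi hρ.integrable hs]
  ring

lemma upperPower_nonneg (hρ : IsPowerDistribution P ρ) {s : ℝ} (hs : 0 ≤ s) :
    0 ≤ upperPower ρ s :=
  setIntegral_nonneg measurableSet_Ioi fun u hu => hρ.nonneg u (hs.trans_lt hu)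

lemma upperPower_le (hρ : IsPowerDistribution P ρ) {s : ℝ} (hs : 0 ≤ s) :
    upperPower ρ s ≤ P := by
  have h : 0 ≤ ∫ u in (0 : ℝ)..s, ρ u := by
    rw [intervalIntegral.integral_of_le hs]
    exact setIntegral_nonneg measurableSet_Ioc fun u hu => hρ.nonneg u hu.1
  have h2 : upperPower ρ 0 ≤ P := hρ.power_le
  linarith [hρ.upperPower_eq hs]

lemma continuousOn_upperPower_Icc (hρ : IsPowerDistribution P ρ) {b : ℝ} (hb : 0 ≤ b) :
    ContinuousOn (upperPower ρ) (Set.Icc 0 b) := by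
  have h := ((hρ.intervalIntegrable hb).absolutelyContinuousOnInterval_intervalIntegral
    (c := 0) (by simp)).continuousOn
  rw [Set.uIcc_of_le hb] at h
  exact (continuousOn_const.sub h).congr fun s hs => hρ.upperPower_eq hs.1

lemma continuousOn_upperPower (hρ : IsPowerDistribution P ρ) :
    ContinuousOn (upperPower ρ) (Set.Ioi 0) := by
  intro s hs
  have hs : 0 < s := hs
  exact ((hρ.continuousOn_upperPower_Icc (b := s + 1) (by linarith)).continuousAt
    (Icc_mem_nhds hs (by linarith))).continuousWithinAt

lemma one_le (hρ : IsPowerDistribution P ρ) (n : ℕ) {s : ℝ} (hs : 0 ≤ s) :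
    1 ≤ 1 + s * (upperPower ρ s / n) := by
  have := hρ.upperPower_nonneg hs
  have : 0 ≤ s * (upperPower ρ s / n) := by positivity
  linarith

lemma layerRate_nonneg (hρ : IsPowerDistribution P ρ) (n : ℕ) {s : ℝ} (hs : 0 < s) :
    0 ≤ layerRate n ρ s := by
  have h1 := hρ.one_le n hs.le
  have h2 := hρ.nonneg s hs
  unfold layerRate
  positivity

lemma layerRate_le (hρ : IsPowerDistribution P ρ) (n : ℕ) {s : ℝ} (hs : 0 < s) :
    layerRate n ρ s ≤ s * (ρ s / n) := by
  have h1 := hρ.one_le n hs.le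
  have h2 := hρ.nonneg s hs
  exact div_le_self (by positivity) h1

lemma aestronglyMeasurable_layerRate (hρ : IsPowerDistribution P ρ) (n : ℕ) :
    AEStronglyMeasurable (layerRate n ρ) (volume.restrict (Set.Ioi 0)) := by
  have h1 : AEMeasurable ρ (volume.restrict (Set.Ioi 0)) :=
    hρ.integrable.aestronglyMeasurable.aemeasurable
  have h2 : AEMeasurable (upperPower ρ) (volume.restrict (Set.Ioi 0)) :=
    hρ.continuousOn_upperPower.aemeasurable measurableSet_Ioi
  unfold layerRate
  exact ((aemeasurable_id.mul (h1.div_const _)).div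
    (aemeasurable_const.add (aemeasurable_id.mul (h2.div_const _)))).aestronglyMeasurable

lemma integrableOn_gammaTail_mul_layerRate (hρ : IsPowerDistribution P ρ) (n : ℕ) :
    IntegrableOn (fun s => gammaTail n s * layerRate n ρ s) (Set.Ioi 0) := by
  refine Integrable.mono' hρ.integrable ?_ ?_
  · exact (continuous_gammaTail n).aestronglyMeasurable.mul (hρ.aestronglyMeasurable_layerRate n)
  · refine (ae_restrict_iff' measurableSet_Ioi).2 (Filter.Eventually.of_forall fun s hs => ?_)
    have hs : 0 < s := hs
    have h1 := hρ.layerRate_nonneg n hs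
    have h2 := hρ.layerRate_le n hs
    have h3 := gammaTail_nonneg n hs.le
    have h4 := hρ.nonneg s hs
    rw [Real.norm_of_nonneg (by positivity)]
    calc gammaTail n s * layerRate n ρ s ≤ gammaTail n s * (s * (ρ s / n)) := by gcongr
      _ = s * gammaTail n s * (ρ s / n) := by ring
      _ ≤ n * 1 * (ρ s / n) := by
        refine mul_le_mul_of_nonneg_right ((mul_gammaTail_le n hs.le).trans ?_) (by positivity)
        gcongr
        exact gammaTail_le_one _ hs.le
      _ ≤ ρ s := by
        rcases Nat.eq_zero_or_pos n with rfl | hn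
        · simpa using h4
        · field_simp; rfl

end IsPowerDistribution

lemma expectedRate_eq {Ω : Type*} [MeasurableSpace Ω] {μ : Measure Ω} [IsProbabilityMeasure μ]
    {n : ℕ} {h : Fin n → Ω → ℂ} (hh : IsRayleighFading μ h) {P : ℝ} {ρ : ℝ → ℝ}
    (hρ : IsPowerDistribution P ρ) :
    expectedRate μ h ρ = ∫ s in Set.Ioi 0, gammaTail n s * layerRate n ρ s := by
  have hG := aemeasurable_channelGain hh
  -- The gain is only a.e. measurable; a measurable version makes the region `s ≤ G ω` measurable in
  -- the product, as Fubini requires.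
  set G := hG.mk with hGdef
  have hGm : Measurable G := hG.measurable_mk
  have hGe : channelGain h =ᵐ[μ] G := hG.ae_eq_mk
  have hset : ∀ s : ℝ, MeasurableSet {ω | s ≤ G ω} := fun s => measurableSet_le measurable_const hGm
  have htail : ∀ s : ℝ, 0 < s → μ.real {ω | s ≤ G ω} = gammaTail n s := by
    intro s hs
    rw [measureReal_def, ← ENNReal.toReal_ofReal (gammaTail_nonneg n hs.le),
      ← measure_le_channelGain hh hs]
    congr 1
    refine measure_congr ?_
    filter_upwards [hGe] with ω hω
    exact congrArg (fun x => s ≤ x) hω.symm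
  have h1 : expectedRate μ h ρ =
      ∫ ω, (∫ s in Set.Ioi (0 : ℝ),
        Set.indicator {ω | s ≤ G ω} (fun _ => layerRate n ρ s) ω) ∂μ := by
    refine integral_congr_ae ?_
    filter_upwards [hGe] with ω hω
    simp only [decodedRate]
    have e : ∀ s, Set.indicator {ω | s ≤ G ω} (fun _ => layerRate n ρ s) ω =
        (Set.Iic (G ω)).indicator (layerRate n ρ) s := by
      intro s
      by_cases hs : s ≤ G ω
      · simp [hs]
      · simp [hs]
    simp only [e]
    rw [setIntegral_indicator measurableSet_Iic, Set.Ioi_inter_Iic, hω]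
  have hinner : ∀ s : ℝ, 0 < s → ∀ c : ℝ,
      ∫ ω, Set.indicator {ω | s ≤ G ω} (fun _ => c) ω ∂μ = gammaTail n s * c := by
    intro s hs c
    rw [integral_indicator_const _ (hset s), htail s hs, smul_eq_mul]
  rw [h1, integral_integral_swap]
  · exact setIntegral_congr_fun measurableSet_Ioi fun s hs => hinner s hs _
  · have hA : MeasurableSet {p : Ω × ℝ | p.2 ≤ G p.1} :=
      measurableSet_le measurable_snd (hGm.comp measurable_fst)
    have e : Function.uncurry (fun ω s =>
        Set.indicator {ω | s ≤ G ω} (fun _ => layerRate n ρ s) ω) =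
        Set.indicator {p : Ω × ℝ | p.2 ≤ G p.1} (fun p => layerRate n ρ p.2) := by
      ext ⟨ω, s⟩
      by_cases hs : s ≤ G ω
      · simp [hs]
      · simp [hs]
    refine (integrable_prod_iff' ?_).2 ⟨?_, ?_⟩
    · rw [e]
      exact (hρ.aestronglyMeasurable_layerRate n).comp_snd.indicator hA
    · exact Filter.Eventually.of_forall fun s => 
        (integrable_const (layerRate n ρ s)).indicator (hset s)
    · refine (hρ.integrableOn_gammaTail_mul_layerRate n).congr ?_
      refine (ae_restrict_iff' measurableSet_Ioi).2 (Filter.Eventually.of_forall fun s hs => ?_)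
      simp only [Function.uncurry_apply_pair, norm_indicator_eq_indicator_norm]
      rw [hinner s hs, Real.norm_of_nonneg (hρ.layerRate_nonneg n hs)]

end MISO
end

/-! ### Integration by parts and pointwise maximization -/

noncomputable section

/-- The logarithm of an absolutely continuous function with values in `[1, ∞)` is absolutely
continuous. -/
lemma AbsolutelyContinuousOnInterval.log_of_one_le {f : ℝ → ℝ} {a b : ℝ}
    (hf : AbsolutelyContinuousOnInterval f a b) (h1 : ∀ x ∈ Set.uIcc a b, 1 ≤ f x) :
    AbsolutelyContinuousOnInterval (fun x => Real.log (f x)) a b := by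
  -- The logarithm is 1-Lipschitz on `[1, ∞)`: `log (u/v) ≤ (u - v)/v ≤ |u - v|`.
  have key : ∀ u v : ℝ, 1 ≤ u → 1 ≤ v → Real.log u - Real.log v ≤ |u - v| := by
    intro u v hu hv
    have hu0 : 0 < u := by linarith
    have hv0 : 0 < v := by linarith
    rw [← Real.log_div hu0.ne' hv0.ne']
    refine (Real.log_le_sub_one_of_pos (by positivity)).trans ?_
    rw [div_sub_one hv0.ne']
    exact (div_le_div_of_nonneg_right (le_abs_self _) hv0.le).trans
      (div_le_self (abs_nonneg _) hv)
  rw [absolutelyContinuousOnInterval_iff] at hf ⊢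
  intro ε hε
  obtain ⟨δ, hδ, H⟩ := hf ε hε
  refine ⟨δ, hδ, fun E hE hEδ => lt_of_le_of_lt (Finset.sum_le_sum fun i hi => ?_) (H E hE hEδ)⟩
  have hu := h1 _ (hE.1 i hi).1
  have hv := h1 _ (hE.1 i hi).2
  rw [Real.dist_eq, Real.dist_eq]
  refine abs_le.2 ⟨?_, key _ _ hu hv⟩
  have := key _ _ hv hu
  rw [abs_sub_comm] at this
  linarith

namespace MISO

/-- The integrand of the expected rate after integration by parts, at residual power `x`. -/
def powerIntegrand (n : ℕ) (s x : ℝ) : ℝ :=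
  gammaTail n s * (x / (1 + s * x)) - gammaDensity n s * Real.log (1 + s * x)

/-- Integration by parts turns the rate of the layers below `b` into an integral that depends on
the power distribution only through the residual power. -/
lemma IsPowerDistribution.integral_gammaTail_mul_layerRate {P : ℝ} {ρ : ℝ → ℝ}
    (hρ : IsPowerDistribution P ρ) {n : ℕ} (hn : 1 ≤ n) {b : ℝ} (hb : 0 ≤ b) :
    IntervalIntegrable (fun s => powerIntegrand n s (upperPower ρ s / n)) volume 0 b ∧
    ∫ s in (0 : ℝ)..b, gammaTail n s * layerRate n ρ s =
      (∫ s in (0 : ℝ)..b, powerIntegrand n s (upperPower ρ s / n)) -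
        gammaTail n b * Real.log (1 + b * (upperPower ρ b / n)) := by
  -- The interval-integral form agrees with the residual power only for `s ≥ 0`, but exposes its
  -- absolute continuity and its a.e. derivative.
  set U : ℝ → ℝ := fun s => upperPower ρ 0 - ∫ u in (0 : ℝ)..s, ρ u with hU
  have hUe : ∀ s, 0 ≤ s → upperPower ρ s = U s := fun s hs => hρ.upperPower_eq hs
  set W : ℝ → ℝ := fun s => 1 + s * ((n : ℝ)⁻¹ * U s) with hW
  have hWe : ∀ s, 0 ≤ s → 1 + s * (upperPower ρ s / n) = W s := by
    intro s hs; rw [hUe s hs, div_eq_inv_mul]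
  have hW1 : ∀ s ∈ Set.uIcc 0 b, 1 ≤ W s := by
    intro s hs
    rw [Set.uIcc_of_le hb] at hs
    rw [← hWe s hs.1]; exact hρ.one_le n hs.1
  have hii := hρ.intervalIntegrable hb
  have acC : ∀ c : ℝ, AbsolutelyContinuousOnInterval (fun _ => c) 0 b := fun c =>
    ContDiffOn.absolutelyContinuousOnInterval contDiffOn_const
  have acU : AbsolutelyContinuousOnInterval U 0 b :=
    (acC _).fun_sub (hii.absolutelyContinuousOnInterval_intervalIntegral (c := 0) (by simp))
  have acId : AbsolutelyContinuousOnInterval (fun s : ℝ => s) 0 b :=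
    ContDiffOn.absolutelyContinuousOnInterval contDiffOn_id
  have acW : AbsolutelyContinuousOnInterval W 0 b :=
    (acC 1).fun_add (acId.fun_mul (acU.const_mul _))
  have acL := acW.log_of_one_le hW1
  have acT : AbsolutelyContinuousOnInterval (gammaTail n) 0 b := by
    refine ContDiffOn.absolutelyContinuousOnInterval (ContDiff.contDiffOn ?_)
    unfold gammaTail
    fun_prop
  have hftc := (acT.fun_mul acL).integral_deriv_eq_sub
  -- As `ρ` is merely integrable, the residual power is differentiable only almost everywhere;
  -- absolute continuity is what validates the fundamental theorem used here.
  have hderiv : ∀ᵐ s, s ∈ Set.uIoc 0 b →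
      deriv (fun s => gammaTail n s * Real.log (W s)) s =
        powerIntegrand n s (upperPower ρ s / n) - gammaTail n s * layerRate n ρ s := by
    filter_upwards [hii.ae_hasDerivAt_integral] with s hs hsb
    have hs0 : 0 < s := by rw [Set.uIoc_of_le hb] at hsb; exact hsb.1
    have hsb' : s ∈ Set.uIcc 0 b := Set.uIoc_subset_uIcc hsb
    have dU : HasDerivAt U (-ρ s) s := by
      simpa using (hs hsb' 0 (by simp)).const_sub (upperPower ρ 0)
    have dW : HasDerivAt W ((n : ℝ)⁻¹ * U s + s * ((n : ℝ)⁻¹ * -ρ s)) s := by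
      refine (((hasDerivAt_id s).fun_mul (dU.const_mul (n : ℝ)⁻¹)).const_add 1).congr_deriv ?_
      simp only [id, one_mul]
    have hWp : W s ≠ 0 := by have := hW1 s hsb'; positivity
    have d := (hasDerivAt_gammaTail hn s).fun_mul (dW.log hWp)
    rw [d.deriv, powerIntegrand, layerRate, hWe s hs0.le, hUe s hs0.le]
    field_simp
    ring
  have hint1 : IntervalIntegrable (fun s => gammaTail n s * layerRate n ρ s) volume 0 b :=
    (intervalIntegrable_iff_integrableOn_Ioc_of_le hb).2
      ((hρ.integrableOn_gammaTail_mul_layerRate n).mono_set Set.Ioc_subset_Ioi_self)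
  have hint2 : IntervalIntegrable (fun s => powerIntegrand n s (upperPower ρ s / n)) volume 0 b := by
    refine ContinuousOn.intervalIntegrable ?_
    rw [Set.uIcc_of_le hb] at hW1 ⊢
    have hc := (hρ.continuousOn_upperPower_Icc hb).div_const (n : ℝ)
    have hc1 : ContinuousOn (fun s => 1 + s * (upperPower ρ s / n)) (Set.Icc 0 b) :=
      continuousOn_const.add (continuousOn_id.mul hc)
    have hne : ∀ s ∈ Set.Icc 0 b, 1 + s * (upperPower ρ s / n) ≠ 0 := by
      intro s hs
      have := hρ.one_le n hs.1
      positivity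
    exact ((continuous_gammaTail n).continuousOn.mul (hc.div hc1 hne)).sub
      ((continuous_gammaDensity n).continuousOn.mul (hc1.log hne))
  refine ⟨hint2, ?_⟩
  rw [intervalIntegral.integral_congr_ae hderiv, intervalIntegral.integral_sub hint2 hint1] at hftc
  rw [hWe b hb]
  have h0 : Real.log (W 0) = 0 := by simp [hW]
  rw [h0] at hftc
  linarith

/-- For fixed `s`, the integrand is largest at the residual power at which `1 + s x` equals
`limitSum n s`, or at the end of the range closest to it. -/
lemma powerIntegrand_le {n : ℕ} {s x y : ℝ} (hs : 0 < s) (hx : 0 ≤ x) (hy : 0 ≤ y)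
    (h : 0 ≤ (limitSum n s - (1 + s * y)) * (y - x)) :
    powerIntegrand n s x ≤ powerIntegrand n s y := by
  have hd := gammaDensity_pos n hs
  have hT : gammaTail n s = limitSum n s * (s * gammaDensity n s) := by
    rw [limitSum_eq n hs]; field_simp
  have hu : 0 < 1 + s * x := by positivity
  have hv : 0 < 1 + s * y := by positivity
  -- With `log t ≤ t - 1` in place of the logarithms, the gain from `x` to `y` is bounded below by a
  -- positive multiple of the quantity in `h`.
  have hlog : Real.log (1 + s * y) - Real.log (1 + s * x) ≤ s * (y - x) / (1 + s * x) := by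
    rw [← Real.log_div hv.ne' hu.ne']
    refine (Real.log_le_sub_one_of_pos (by positivity)).trans (le_of_eq ?_)
    field_simp
    ring
  have e : powerIntegrand n s y - powerIntegrand n s x =
      gammaDensity n s * (s * limitSum n s * (y - x) / ((1 + s * x) * (1 + s * y)) -
        (Real.log (1 + s * y) - Real.log (1 + s * x))) := by
    unfold powerIntegrand
    rw [hT]
    field_simp
    ring
  have e2 : s * limitSum n s * (y - x) / ((1 + s * x) * (1 + s * y)) - s * (y - x) / (1 + s * x) =
      s * ((limitSum n s - (1 + s * y)) * (y - x)) / ((1 + s * x) * (1 + s * y)) := by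
    field_simp
  have h3 : 0 ≤ s * ((limitSum n s - (1 + s * y)) * (y - x)) / ((1 + s * x) * (1 + s * y)) := by
    positivity
  have h4 : 0 ≤ powerIntegrand n s y - powerIntegrand n s x := by
    rw [e]
    exact mul_nonneg hd.le (by linarith)
  linarith

/-! ### The optimal power distribution -/

/-- The power of the layers above `s` under the optimal distribution, for `s` in its support. -/
def optimalUpperPower (n : ℕ) (s : ℝ) : ℝ :=
  n * (limitSum n s - 1) / s

/-- The power density of the optimal distribution on its support. -/
def optimalDensity (n : ℕ) (s : ℝ) : ℝ :=
  n * limitSum n s * (n + 1 - s) / s ^ 2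

/-- The optimal power distribution, supported on `(s₀, s₁]`. -/
def optimalPower (n : ℕ) (s₀ s₁ : ℝ) : ℝ → ℝ :=
  (Set.Ioc s₀ s₁).indicator (optimalDensity n)

/-- The terms free of `limitSum` cancel, so the density factors and its sign is that of `n + 1 - s`.
-/
lemma hasDerivAt_optimalUpperPower {n : ℕ} (hn : 1 ≤ n) {s : ℝ} (hs : 0 < s) :
    HasDerivAt (optimalUpperPower n) (-optimalDensity n s) s := by
  refine ((((hasDerivAt_limitSum hn hs).sub_const 1).const_mul (n : ℝ)).div
    (hasDerivAt_id s) hs.ne').congr_deriv ?_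
  simp only [optimalDensity, id]
  field_simp
  ring

lemma continuousOn_optimalDensity (n : ℕ) : ContinuousOn (optimalDensity n) (Set.Ioi 0) := by
  unfold optimalDensity
  refine ((continuousOn_const.mul (continuousOn_limitSum n)).mul (by fun_prop)).div (by fun_prop) ?_
  intro x hx
  have hx : 0 < x := hx
  positivity

lemma integral_optimalDensity {n : ℕ} (hn : 1 ≤ n) {a b : ℝ} (ha : 0 < a) (hab : a ≤ b) :
    ∫ s in Set.Ioc a b, optimalDensity n s = optimalUpperPower n a - optimalUpperPower n b := by
  have hsub : Set.uIcc a b ⊆ Set.Ioi 0 := by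
    rw [Set.uIcc_of_le hab]; exact fun x hx => ha.trans_le hx.1
  have h := intervalIntegral.integral_eq_sub_of_hasDerivAt
    (fun x hx => (hasDerivAt_optimalUpperPower hn (hsub hx)).neg)
    (((continuousOn_optimalDensity n).mono hsub).neg.neg.intervalIntegrable)
  rw [← intervalIntegral.integral_of_le hab]
  simp only [neg_neg, Pi.neg_apply] at h
  rw [h]; ring

section Optimal

variable {n : ℕ} {P s₀ s₁ : ℝ}

lemma upperPower_optimalPower_of_le (hn : 1 ≤ n) (h0 : 0 < s₀)
    (h1L : limitSum n s₁ = 1) {s : ℝ} (h : max s s₀ ≤ s₁) :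
    upperPower (optimalPower n s₀ s₁) s = optimalUpperPower n (max s s₀) := by
  rw [upperPower, optimalPower, setIntegral_indicator measurableSet_Ioc]
  have e : Set.Ioi s ∩ Set.Ioc s₀ s₁ = Set.Ioc (max s s₀) s₁ := by
    ext x; simp only [Set.mem_inter_iff, Set.mem_Ioi, Set.mem_Ioc, max_lt_iff]; tauto
  rw [e, integral_optimalDensity hn (lt_max_of_lt_right h0) h]
  simp [optimalUpperPower, h1L]

lemma upperPower_optimalPower_of_ge {s : ℝ} (h : s₁ ≤ s) :
    upperPower (optimalPower n s₀ s₁) s = 0 := by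
  rw [upperPower, optimalPower, setIntegral_indicator measurableSet_Ioc]
  have e : Set.Ioi s ∩ Set.Ioc s₀ s₁ = ∅ := by
    ext x
    simp only [Set.mem_inter_iff, Set.mem_Ioi, Set.mem_Ioc, Set.mem_empty_iff_false, iff_false]
    intro hx
    linarith [hx.1, hx.2.2]
  simp [e]

lemma lt_of_limitSum (hn : 1 ≤ n) (hP : 0 < P) (h0 : 0 < s₀)
    (h0L : limitSum n s₀ = 1 + P / n * s₀) (h1 : 0 < s₁) (h1L : limitSum n s₁ = 1) : s₀ < s₁ := by
  have hn0 : (0 : ℝ) < n := by exact_mod_cast hn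
  refine ((limitSum_strictAntiOn hn).lt_iff_gt h1 h0).1 ?_
  rw [h0L, h1L]
  have : 0 < P / n * s₀ := by positivity
  linarith

/-- Keeps the support below `n + 1`, where the optimal density is nonnegative. -/
lemma le_of_limitSum_eq_one (h1 : 0 < s₁) (h1L : limitSum n s₁ = 1) : s₁ ≤ n := by
  by_contra! h
  have h2 := limitSum_le n h.le h1
  rw [h1L, le_div_iff₀ h1] at h2
  linarith

lemma upperPower_optimalPower_of_le_left (hn : 1 ≤ n) (h0 : 0 < s₀)
    (h0L : limitSum n s₀ = 1 + P / n * s₀) (h1L : limitSum n s₁ = 1) (h01 : s₀ ≤ s₁)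
    {s : ℝ} (h : s ≤ s₀) : upperPower (optimalPower n s₀ s₁) s = P := by
  have hn0 : (0 : ℝ) < n := by exact_mod_cast hn
  rw [upperPower_optimalPower_of_le hn h0 h1L (max_le (h.trans h01) h01), max_eq_right h,
    optimalUpperPower, h0L]
  field_simp
  ring

/-- The stationarity condition holds throughout the support; it also makes the denominator of the
layer rate cancel against the optimal density. -/
lemma one_add_mul_upperPower_optimalPower (hn : 1 ≤ n) (h0 : 0 < s₀)
    (h1L : limitSum n s₁ = 1) {s : ℝ} (h : s ∈ Set.Icc s₀ s₁) :
    1 + s * (upperPower (optimalPower n s₀ s₁) s / n) = limitSum n s := by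
  have hn0 : (0 : ℝ) < n := by exact_mod_cast hn
  have hs : 0 < s := h0.trans_le h.1
  rw [upperPower_optimalPower_of_le hn h0 h1L (max_le h.2 (h.1.trans h.2)), max_eq_left h.1,
    optimalUpperPower]
  field_simp
  ring

lemma isPowerDistribution_optimalPower (hn : 1 ≤ n) (hP : 0 < P) (h0 : 0 < s₀)
    (h0L : limitSum n s₀ = 1 + P / n * s₀) (h1 : 0 < s₁) (h1L : limitSum n s₁ = 1) :
    IsPowerDistribution P (optimalPower n s₀ s₁) where
  nonneg s hs := by
    refine Set.indicator_nonneg (fun x hx => ?_) s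
    have hx0 : 0 < x := h0.trans hx.1
    have h2 := le_of_limitSum_eq_one h1 h1L
    have h3 : 0 ≤ (n : ℝ) + 1 - x := by linarith [hx.2]
    have h4 : 0 < limitSum n x := lt_of_lt_of_le (by positivity) (one_div_le_limitSum hn hx0)
    unfold optimalDensity
    positivity
  integrable := by
    have h : IntegrableOn (optimalDensity n) (Set.Icc s₀ s₁) :=
      ((continuousOn_optimalDensity n).mono fun x hx => h0.trans_le hx.1).integrableOn_Icc
    exact ((integrable_indicator_iff measurableSet_Ioc).2
      (h.mono_set Set.Ioc_subset_Icc_self)).integrableOn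
  power_le := (upperPower_optimalPower_of_le_left hn h0 h0L h1L
    (lt_of_limitSum hn hP h0 h0L h1 h1L).le h0.le).le

lemma integral_layerRate_optimalPower (hn : 1 ≤ n) (hP : 0 < P) (h0 : 0 < s₀)
    (h0L : limitSum n s₀ = 1 + P / n * s₀) (h1 : 0 < s₁) (h1L : limitSum n s₁ = 1) :
    ∫ s in Set.Ioi 0, gammaTail n s * layerRate n (optimalPower n s₀ s₁) s =
      closedForm n s₁ - closedForm n s₀ := by
  have hn0 : (0 : ℝ) < n := by exact_mod_cast hn
  have h01 := lt_of_limitSum hn hP h0 h0L h1 h1L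
  have hsub : Set.uIcc s₀ s₁ ⊆ Set.Ioi 0 := by
    rw [Set.uIcc_of_le h01.le]; exact fun x hx => h0.trans_le hx.1
  have hc : ContinuousOn (fun s : ℝ => gammaTail n s * (n + 1 - s) / s) (Set.Ioi 0) := by
    refine ((continuous_gammaTail n).continuousOn.mul (by fun_prop)).div continuousOn_id ?_
    exact fun x hx => ne_of_gt hx
  rw [← intervalIntegral.integral_eq_sub_of_hasDerivAt
    (fun x hx => hasDerivAt_closedForm hn (hsub hx)) ((hc.mono hsub).intervalIntegrable),
    intervalIntegral.integral_of_le h01.le]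
  have e : ∀ s ∈ Set.Ioi (0 : ℝ), gammaTail n s * layerRate n (optimalPower n s₀ s₁) s =
      (Set.Ioc s₀ s₁).indicator (fun s : ℝ => gammaTail n s * (n + 1 - s) / s) s := by
    intro s hs
    by_cases hsI : s ∈ Set.Ioc s₀ s₁
    · have hs : 0 < s := hs
      have hL : 0 < limitSum n s := lt_of_lt_of_le (by positivity) (one_div_le_limitSum hn hs)
      rw [Set.indicator_of_mem hsI, layerRate,
        one_add_mul_upperPower_optimalPower hn h0 h1L ⟨hsI.1.le, hsI.2⟩, optimalPower,
        Set.indicator_of_mem hsI, optimalDensity]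
      field_simp
    · rw [Set.indicator_of_notMem hsI, layerRate, optimalPower, Set.indicator_of_notMem hsI]
      simp
  rw [setIntegral_congr_fun measurableSet_Ioi e, setIntegral_indicator measurableSet_Ioc,
    Set.inter_eq_right.2 (show Set.Ioc s₀ s₁ ⊆ Set.Ioi 0 from fun x hx => h0.trans hx.1)]

lemma powerIntegrand_le_optimalPower (hn : 1 ≤ n) (hP : 0 < P) (h0 : 0 < s₀)
    (h0L : limitSum n s₀ = 1 + P / n * s₀) (h1 : 0 < s₁) (h1L : limitSum n s₁ = 1)
    {s x : ℝ} (hs : 0 < s) (hx : 0 ≤ x) (hxP : x ≤ P / n) :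
    powerIntegrand n s x ≤ powerIntegrand n s (upperPower (optimalPower n s₀ s₁) s / n) := by
  have h01 := lt_of_limitSum hn hP h0 h0L h1 h1L
  have hanti := (limitSum_strictAntiOn hn).antitoneOn
  have hU := (isPowerDistribution_optimalPower hn hP h0 h0L h1 h1L).upperPower_nonneg hs.le
  refine powerIntegrand_le hs hx (by positivity) ?_
  -- The three regimes of the clipped maximizer: both factors nonnegative below `s₀`, the first zero
  -- in between, both nonpositive above `s₁`.
  rcases le_total s s₀ with h | h
  · rw [upperPower_optimalPower_of_le_left hn h0 h0L h1L h01.le h]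
    have hL := hanti hs h0 h
    have : s * (P / n) ≤ s₀ * (P / n) := by gcongr
    exact mul_nonneg (by linarith) (by linarith)
  rcases le_total s s₁ with h' | h'
  · rw [one_add_mul_upperPower_optimalPower hn h0 h1L ⟨h, h'⟩]
    simp
  · rw [upperPower_optimalPower_of_ge h']
    have hL := hanti h1 hs h'
    exact mul_nonneg_of_nonpos_of_nonpos (by simp; linarith) (by simpa using hx)

/-- Compare on `[0, b]` and let `b → ∞`. Once `b ≥ s₁` the optimum has no boundary term, while the
competitor's is subtracted and nonnegative, so its decay at infinity is never needed. -/
lemma integral_layerRate_le (hn : 1 ≤ n) (hP : 0 < P) (h0 : 0 < s₀)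
    (h0L : limitSum n s₀ = 1 + P / n * s₀) (h1 : 0 < s₁) (h1L : limitSum n s₁ = 1)
    {ρ : ℝ → ℝ} (hρ : IsPowerDistribution P ρ) :
    ∫ s in Set.Ioi 0, gammaTail n s * layerRate n ρ s ≤
      ∫ s in Set.Ioi 0, gammaTail n s * layerRate n (optimalPower n s₀ s₁) s := by
  have hopt := isPowerDistribution_optimalPower hn hP h0 h0L h1 h1L
  refine le_of_tendsto_of_tendsto
    (intervalIntegral_tendsto_integral_Ioi 0 (hρ.integrableOn_gammaTail_mul_layerRate n)
      Filter.tendsto_id)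
    (intervalIntegral_tendsto_integral_Ioi 0 (hopt.integrableOn_gammaTail_mul_layerRate n)
      Filter.tendsto_id) ?_
  filter_upwards [Filter.eventually_ge_atTop s₁] with b hb
  have hb0 : 0 ≤ b := h1.le.trans hb
  obtain ⟨i1, e1⟩ := hρ.integral_gammaTail_mul_layerRate hn hb0
  obtain ⟨i2, e2⟩ := hopt.integral_gammaTail_mul_layerRate hn hb0
  simp only [id]
  rw [e1, e2, upperPower_optimalPower_of_ge hb]
  have hle : ∫ s in (0 : ℝ)..b, powerIntegrand n s (upperPower ρ s / n) ≤
      ∫ s in (0 : ℝ)..b, powerIntegrand n s (upperPower (optimalPower n s₀ s₁) s / n) := by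
    refine intervalIntegral.integral_mono_on_of_le_Ioo hb0 i1 i2 fun s hs => ?_
    have hU := hρ.upperPower_nonneg hs.1.le
    refine powerIntegrand_le_optimalPower hn hP h0 h0L h1 h1L hs.1 (by positivity) ?_
    have := hρ.upperPower_le hs.1.le
    gcongr
  have hlog : 0 ≤ gammaTail n b * Real.log (1 + b * (upperPower ρ b / n)) :=
    mul_nonneg (gammaTail_nonneg n hb0) (Real.log_nonneg (hρ.one_le n hb0))
  simp only [zero_div, mul_zero, add_zero, Real.log_one]
  linarith

end Optimal

end MISO

end

theorem mainTheorem3 {Ω : Type*} [MeasurableSpace Ω] (μ : MeasureTheory.Measure Ω)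
    [MeasureTheory.IsProbabilityMeasure μ] (n : ℕ) (hn : 1 ≤ n) (P : ℝ) (hP : 0 < P)
    (h : Fin n → Ω → ℂ) (hh : MISO.IsRayleighFading μ h) :
    (∃! s₀ : ℝ, 0 < s₀ ∧ MISO.limitSum n s₀ = 1 + P / n * s₀) ∧
    (∃! s₁ : ℝ, 0 < s₁ ∧ MISO.limitSum n s₁ = 1) ∧
    ∀ s₀ s₁ : ℝ,
      0 < s₀ → MISO.limitSum n s₀ = 1 + P / n * s₀ →
      0 < s₁ → MISO.limitSum n s₁ = 1 →
      IsGreatest {r : ℝ | ∃ ρ : ℝ → ℝ, MISO.IsPowerDistribution P ρ ∧ r = MISO.expectedRate μ h ρ}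
        (MISO.closedForm n s₁ - MISO.closedForm n s₀) := by
  refine ⟨MISO.existsUnique_limitSum hn (by positivity), ?_, ?_⟩
  -- The case of slope `c = 0`.
  · simpa using MISO.existsUnique_limitSum hn le_rfl
  intro s₀ s₁ h0 h0L h1 h1L
  have hopt := MISO.isPowerDistribution_optimalPower hn hP h0 h0L h1 h1L
  have hval := MISO.integral_layerRate_optimalPower hn hP h0 h0L h1 h1L
  refine ⟨⟨_, hopt, ?_⟩, ?_⟩
  · rw [MISO.expectedRate_eq hh hopt, hval]
  · rintro r ⟨ρ, hρ, rfl⟩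
    rw [MISO.expectedRate_eq hh hρ, ← hval]
    exact MISO.integral_layerRate_le hn hP h0 h0L h1 h1L hρ
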